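/- All rings are associative with $1$. For a ring $R$ let $\mathcal C_R$ be the set of regular elements (elements that are neither left nor right zero divisors), and let $Q_{l,cl}(R)=\mathcal C_R^{-1}R=\{s^{-1}r : s\in\mathcal C_R,\ r\in R\}$ be its classical left quotient ring, which exists if and only if $\mathcal C_R$ is a left Ore set. A ring is semiprime if the intersection of all its prime ideals is zero; it is left Goldie if it contains no infinite direct sum of nonzero left ideals and satisfies the ascending chain condition on left annihilators; $\min(R)$ denotes the set of minimal prime ideals of $R$. Let $R$ be a ring whose centre $Z(R)=\prod_{i=1}^n K_i$ is a finite direct product of fields $K_i$, and let $1=\sum_{i=1}^n e_i$ be the corresponding sum of orthogonal idempotents. Then the following statements are equivalent: 1. The ring $Q_{l,cl}(R)$ exists and is a semisimple Artinian ring. 2. The ring $R$ is semiprime and the factor ring $R/R(1-e_i)$ is a left Goldie ring for all $i=1,\dots,n$. If one of the equivalent conditions holds, then the rings $Q_{l,cl}(R/R(1-e_i))$ exist, there are ring isomorphisms $$Q_{l,cl}(R)\simeq\prod_{i=1}^n Q_{l,cl}(R/R(1-e_i)),\qquad Q_{l,cl}(R/R(1-e_i))\simeq Q_{l,cl}(R)/Q_{l,cl}(R)(1-e_i)\quad\text{for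 all } i=1,\dots,n,$$ and the map $\min(R)\to\min(Z(R))$, $\mathfrak p\mapsto\mathfrak p\cap Z(R)$, is well defined and surjective. -/

import Mathlib

open scoped nonZeroDivisors OreLocalization

universe u v

namespace NoncommRing

section Ideals

/-- A prime ideal of a (not necessarily commutative) ring: a proper two-sided ideal `P` such that
`I * J ≤ P` implies `I ≤ P` or `J ≤ P` for all two-sided ideals `I` and `J`.
(Mathlib's `Ideal.IsPrime` means "completely prime" over a noncommutative ring.) -/
structure IsPrimeIdeal {R : Type u} [Ring R] (P : Ideal R) : Prop where
  isTwoSided : P.IsTwoSided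
  ne_top : P ≠ ⊤
  le_or_le : ∀ I J : Ideal R, I.IsTwoSided → J.IsTwoSided → I * J ≤ P → I ≤ P ∨ J ≤ P

/-- The set `min(R)` of minimal prime ideals of `R`. -/
def minPrimes (R : Type u) [Ring R] : Set (Ideal R) :=
  {P | Minimal IsPrimeIdeal P}

/-- The prime radical of `R`: the intersection of all prime ideals. -/
def primeRadical (R : Type u) [Ring R] : Ideal R :=
  sInf {P | IsPrimeIdeal P}

/-- A ring is semiprime if its prime radical is zero. -/
def IsSemiprimeRing (R : Type u) [Ring R] : Prop :=
  primeRadical R = ⊥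

/-- The left annihilator `{a | a * x = 0 for all x ∈ X}` of a subset `X` of `R`. -/
def leftAnnihilator {R : Type u} [Ring R] (X : Set R) : Ideal R where
  carrier := {a | ∀ x ∈ X, a * x = 0}
  zero_mem' := fun x _ => zero_mul x
  add_mem' := fun ha hb x hx => by rw [add_mul, ha x hx, hb x hx, add_zero]
  smul_mem' := fun c a ha x hx => by rw [smul_eq_mul, mul_assoc, ha x hx, mul_zero]

/-- A left Goldie ring: there are no infinite direct sums of nonzero left ideals, and the
ascending chain condition holds for left annihilators. -/
structure IsLeftGoldie (R : Type u) [Ring R] : Prop where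
  finite_rank : ¬ ∃ I : ℕ → Ideal R, (∀ n, I n ≠ ⊥) ∧ iSupIndep I
  acc_leftAnnihilator : ∀ X : ℕ → Set R, Monotone (fun n => leftAnnihilator (X n)) →
    ∃ n, ∀ m, n ≤ m → leftAnnihilator (X m) = leftAnnihilator (X n)

/-- The left ideal `R z` generated by a central element `z` is two-sided. -/
instance isTwoSided_span_center {R : Type u} [Ring R] (z : Subring.center R) :
    (Ideal.span {(z : R)}).IsTwoSided where
  mul_mem_of_left := by
    intro a b ha
    obtain ⟨c, rfl⟩ := Ideal.mem_span_singleton'.1 ha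
    refine Ideal.mem_span_singleton'.2 ⟨c * b, ?_⟩
    rw [mul_assoc, mul_assoc, Subring.mem_center_iff.1 z.2 b]

/-- The factor ring `R / R z` by the ideal generated by a central element `z`. -/
abbrev FactorRing (R : Type u) [Ring R] (z : Subring.center R) : Type u :=
  R ⧸ Ideal.span {(z : R)}

end Ideals

section QuotientRing

/-- The left Ore condition for the multiplicative set `R⁰` of regular elements (two-sided
non-zero-divisors) of `R`, that is, the condition for the classical left quotient ring of `R` to
exist. -/
def HasLeftQuotientRing (R : Type u) [Ring R] : Prop :=
  ∀ (r : R) (s : R⁰), ∃ (r' : R) (s' : R⁰), (s' : R) * r = r' * (s : R)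

theorem HasLeftQuotientRing.nonempty_oreSet {R : Type u} [Ring R] (h : HasLeftQuotientRing R) :
    Nonempty (OreLocalization.OreSet R⁰) :=
  OreLocalization.nonempty_oreSet_iff.2 ⟨fun r₁ r₂ s hs => ⟨1, by
    have h0 : (r₁ - r₂) * (s : R) = 0 := by rw [sub_mul, hs, sub_self]
    rw [sub_eq_zero.1 (s.2.2 _ h0)]⟩, h⟩

/-- Ore data on the regular elements, chosen from the left Ore condition. -/
@[reducible]
noncomputable def HasLeftQuotientRing.oreSet {R : Type u} [Ring R] (h : HasLeftQuotientRing R) :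
    OreLocalization.OreSet R⁰ :=
  h.nonempty_oreSet.some

/-- The classical left quotient ring of `R`, i.e. the left Ore localization of `R` at the set of
all its regular elements; its elements are the left fractions `s⁻¹ r`. -/
def LeftQuotientRing (R : Type u) [Ring R] (h : HasLeftQuotientRing R) : Type u :=
  letI := h.oreSet
  OreLocalization R⁰ R

namespace LeftQuotientRing

noncomputable instance instRing (R : Type u) [Ring R] (h : HasLeftQuotientRing R) :
    Ring (LeftQuotientRing R h) :=
  letI := h.oreSet
  inferInstanceAs (Ring (OreLocalization R⁰ R))

/-- The canonical homomorphism `r ↦ r / 1`. -/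
noncomputable def of (R : Type u) [Ring R] (h : HasLeftQuotientRing R) :
    R →+* LeftQuotientRing R h :=
  letI := h.oreSet
  (OreLocalization.numeratorRingHom : R →+* OreLocalization R⁰ R)

theorem of_mem_center {R : Type u} [Ring R] (h : HasLeftQuotientRing R) (z : Subring.center R) :
    of R h z ∈ Subring.center (LeftQuotientRing R h) := by
  let := h.oreSet
  refine Subring.mem_center_iff.2 fun x => ?_
  change OreLocalization R⁰ R at x
  change x * ((z : R) /ₒ (1 : R⁰)) = ((z : R) /ₒ (1 : R⁰)) * x
  have hz : ∀ g : R, g * (z : R) = z * g := Subring.mem_center_iff.1 z.2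
  induction x using OreLocalization.ind with
  | _ r s =>
    rw [OreLocalization.mul_div_one,
      OreLocalization.oreDiv_mul_char _ _ _ _ (z : R) s (hz s), mul_one, hz r]

/-- The image in the classical left quotient ring of a central element, as a central element. -/
noncomputable def ofCenter (R : Type u) [Ring R] (h : HasLeftQuotientRing R)
    (z : Subring.center R) : Subring.center (LeftQuotientRing R h) :=
  ⟨of R h z, of_mem_center h z⟩

end LeftQuotientRing

end QuotientRing

end NoncommRing

/-! The idempotents `e i` split `R` as the product of the rings `R/R(1 - e i)`, so the equivalence
is Goldie's theorem applied to each factor. To avoid computing with fractions, a quotient ring is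
handled as a map satisfying `IsLeftQuotientMap`. Such a map determines its target up to isomorphism,
and the notion passes to products (`IsLeftQuotientMap.piMap`) and to factors by central idempotents
(`IsLeftQuotientMap.factorRing`); this yields both families of isomorphisms. Goldie's theorem turns
on one property: every essential left ideal contains a regular element. Semiprime left Goldie rings
have it (`IsLeftGoldie.exists_mem_nonZeroDivisors`), and it gives both the Ore condition and
complements in the quotient ring. Conversely, a semisimple quotient ring forces it, whence
semiprimeness; the chain conditions descend from the Noetherian quotient ring. For minimal primes,
the centre is zero-dimensional, so all its primes are minimal and maximal, and inclusions between
contracted primes are equalities. -/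

namespace NoncommRing

/-! ### Quotient rings up to isomorphism, products and central factors. -/

section QuotientMaps

/-- A ring homomorphism `f : R → T` exhibiting `T` as a classical left quotient ring of `R`. -/
structure IsLeftQuotientMap {R T : Type*} [Ring R] [Ring T] (f : R →+* T) : Prop where
  isUnit : ∀ s ∈ R⁰, IsUnit (f s)
  injective : Function.Injective f
  exists_mul_eq : ∀ t, ∃ s ∈ R⁰, ∃ r, f s * t = f r

theorem isLeftQuotientMap_of {R : Type*} [Ring R] (h : HasLeftQuotientRing R) :
    IsLeftQuotientMap (LeftQuotientRing.of R h) := by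
  let := h.oreSet
  refine ⟨fun s hs => ?_, ?_, fun t => ?_⟩
  · exact OreLocalization.numerator_isUnit (⟨s, hs⟩ : R⁰)
  · exact OreLocalization.numeratorHom_inj (S := R⁰) fun s hs => hs.1
  · change OreLocalization R⁰ R at t
    induction t using OreLocalization.ind with
    | _ r s =>
      refine ⟨s, s.2, r, ?_⟩
      change ((s : R) /ₒ (1 : R⁰)) * (r /ₒ s) = r /ₒ (1 : R⁰)
      exact OreLocalization.mul_cancel

namespace IsLeftQuotientMap

variable {R : Type*} {T : Type*} [Ring R] [Ring T] {f : R →+* T}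

theorem hasLeftQuotientRing (hf : IsLeftQuotientMap f) : HasLeftQuotientRing R := by
  intro r s
  obtain ⟨u, hu⟩ := hf.isUnit s s.2
  obtain ⟨s', hs', r', h⟩ := hf.exists_mul_eq (f r * ↑u⁻¹)
  refine ⟨r', ⟨s', hs'⟩, hf.injective ?_⟩
  rw [map_mul, map_mul, ← h, ← hu]
  simp [mul_assoc]

theorem nonempty_ringEquiv (hf : IsLeftQuotientMap f) (h : HasLeftQuotientRing R) :
    Nonempty (LeftQuotientRing R h ≃+* T) := by
  let := h.oreSet
  let fS : R⁰ →* Tˣ :=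
    IsUnit.liftRight ((f : R →* T).comp (Submonoid.subtype R⁰)) fun s => hf.isUnit s s.2
  have hfS : ∀ s : R⁰, f s = fS s := fun s => rfl
  let g : OreLocalization R⁰ R →+* T := OreLocalization.universalHom f fS hfS
  have hg : ∀ (r : R) (s : R⁰), g (r /ₒ s) = ((fS s)⁻¹ : Tˣ) * f r := fun r s =>
    OreLocalization.universalHom_apply ..
  refine ⟨RingEquiv.ofBijective (R := OreLocalization R⁰ R) g ⟨?_, fun t => ?_⟩⟩
  · refine (injective_iff_map_eq_zero g).2 fun x hx => ?_
    induction x using OreLocalization.ind with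
    | _ r s =>
      rw [hg, Units.mul_right_eq_zero] at hx
      rw [hf.injective (hx.trans (map_zero f).symm), OreLocalization.zero_oreDiv]
  · obtain ⟨s, hs, r, h⟩ := hf.exists_mul_eq t
    refine ⟨r /ₒ (⟨s, hs⟩ : R⁰), ?_⟩
    rw [hg, ← h, Units.inv_mul_eq_iff_eq_mul, ← hfS]

theorem comp_ringEquiv {R' : Type*} [Ring R'] (hf : IsLeftQuotientMap f) (σ : R' ≃+* R) :
    IsLeftQuotientMap (f.comp (σ : R' →+* R)) := by
  have hσ : ∀ s, σ s ∈ R⁰ ↔ s ∈ R'⁰ := fun s => by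
    simp only [mem_nonZeroDivisors_iff, σ.surjective.forall, ← map_mul,
      EmbeddingLike.map_eq_zero_iff]
  refine ⟨fun s hs => hf.isUnit _ ((hσ s).2 hs), hf.injective.comp σ.injective, fun t => ?_⟩
  obtain ⟨s, hs, r, h⟩ := hf.exists_mul_eq t
  exact ⟨σ.symm s, (hσ _).1 (by simpa using hs), σ.symm r, by simpa using h⟩

end IsLeftQuotientMap

theorem mem_nonZeroDivisors_pi {ι : Type*} {R : ι → Type*} [∀ i, Ring (R i)] {s : ∀ i, R i} :
    s ∈ (∀ i, R i)⁰ ↔ ∀ i, s i ∈ (R i)⁰ := by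
  classical
  simp only [mem_nonZeroDivisors_iff]
  refine ⟨fun h i => ⟨fun x hx => ?_, fun x hx => ?_⟩, fun h => ⟨fun x hx => ?_, fun x hx => ?_⟩⟩
  · have := h.1 (Pi.single i x) (by
      funext j
      by_cases hj : j = i
      · subst hj; simpa using hx
      · simp [hj])
    simpa using congrFun this i
  · have := h.2 (Pi.single i x) (by
      funext j
      by_cases hj : j = i
      · subst hj; simpa using hx
      · simp [hj])
    simpa using congrFun this i
  · exact funext fun i => (h i).1 _ (congrFun hx i)
  · exact funext fun i => (h i).2 _ (congrFun hx i)

theorem IsLeftQuotientMap.piMap {ι : Type*} {R T : ι → Type*} [∀ i, Ring (R i)]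
    [∀ i, Ring (T i)] {f : ∀ i, R i →+* T i} (hf : ∀ i, IsLeftQuotientMap (f i)) :
    IsLeftQuotientMap (RingHom.pi fun i => (f i).comp (Pi.evalRingHom R i)) := by
  refine ⟨fun s hs => ?_, fun x y hxy => ?_, fun t => ?_⟩
  · exact Pi.isUnit_iff.2 fun i => (hf i).isUnit _ (mem_nonZeroDivisors_pi.1 hs i)
  · exact funext fun i => (hf i).injective (congrFun hxy i)
  · choose s hs r h using fun i => (hf i).exists_mul_eq (t i)
    exact ⟨s, mem_nonZeroDivisors_pi.2 hs, r, funext h⟩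

/-- Turns every computation modulo `R(1 - e)` into an identity in `R` multiplied by `e`. -/
theorem mk_one_sub_eq_zero_iff {R : Type*} [Ring R] {e : Subring.center R} (he : e * e = e)
    {x : R} : (Ideal.Quotient.mk (Ideal.span {((1 - e : Subring.center R) : R)}) x = 0) ↔
      x * e = 0 := by
  have he' : (e : R) * e = e := congrArg Subtype.val he
  rw [Ideal.Quotient.eq_zero_iff_mem, Ideal.mem_span_singleton']
  constructor
  · rintro ⟨a, rfl⟩
    simp [mul_assoc, sub_mul, he']
  · exact fun h => ⟨x, by simp [mul_sub, h]⟩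

theorem IsLeftQuotientMap.factorRing {R T : Type*} [Ring R] [Ring T] {f : R →+* T}
    (hf : IsLeftQuotientMap f) {e : Subring.center R} (he : e * e = e)
    {e' : Subring.center T} (he' : f e = e') :
    ∃ g : FactorRing R (1 - e) →+* FactorRing T (1 - e'), IsLeftQuotientMap g := by
  have hee : (e : R) * e = e := congrArg Subtype.val he
  have hc : ∀ x : R, x * e = e * x := Subring.mem_center_iff.1 e.2
  have hee' : e' * e' = e' := Subtype.ext (by
    rw [Subring.coe_mul, ← he', ← map_mul, hee])
  let g : FactorRing R (1 - e) →+* FactorRing T (1 - e') :=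
    Ideal.Quotient.lift _ ((Ideal.Quotient.mk _).comp f) fun a ha => by
      rw [← Ideal.Quotient.eq_zero_iff_mem, mk_one_sub_eq_zero_iff he] at ha
      rw [RingHom.comp_apply, mk_one_sub_eq_zero_iff hee', ← he', ← map_mul, ha, map_zero]
  have hg : ∀ x, g (Ideal.Quotient.mk _ x) = Ideal.Quotient.mk _ (f x) := fun x => rfl
  refine ⟨g, fun s hs => ?_, ?_, fun t => ?_⟩
  · obtain ⟨s, rfl⟩ := Ideal.Quotient.mk_surjective s
    -- A regular class need not have a regular representative `s`; replacing its other component by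
    -- `1` gives one.
    have hreg : s * e + (1 - e) ∈ R⁰ := by
      refine ⟨fun x hx => ?_, fun x hx => ?_⟩
      · have h1 : s * x * e = 0 := by
          calc s * x * e = ((s * e + (1 - e)) * x) * e := by
                simp only [add_mul, sub_mul, one_mul, mul_assoc, ← hc x, hee]; simp
            _ = 0 := by rw [hx, zero_mul]
        have h2 : x * e = 0 := (mk_one_sub_eq_zero_iff he).1 (hs.1 _ (by
          rw [← map_mul]; exact (mk_one_sub_eq_zero_iff he).2 h1))
        rwa [add_mul, mul_assoc, sub_mul, ← hc x, h2, mul_zero, zero_add, one_mul, sub_zero] at hx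
      · have h1 : x * s * e = 0 := by
          calc x * s * e = (x * (s * e + (1 - e))) * e := by
                simp only [mul_add, mul_sub, add_mul, sub_mul, mul_one, mul_assoc, hee]; simp
            _ = 0 := by rw [hx, zero_mul]
        have h2 : x * e = 0 := (mk_one_sub_eq_zero_iff he).1 (hs.2 _ (by
          rw [← map_mul]; exact (mk_one_sub_eq_zero_iff he).2 h1))
        rwa [mul_add, hc s, ← mul_assoc, mul_sub, h2, zero_mul, zero_add, mul_one, sub_zero] at hx
    have key : g (Ideal.Quotient.mk _ s) =
        Ideal.Quotient.mk _ (f (s * e + (1 - e))) := by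
      rw [← hg]
      congr 1
      rw [← sub_eq_zero, ← map_sub, mk_one_sub_eq_zero_iff he]
      simp [sub_mul, add_mul, mul_assoc, hee]
    rw [key]
    exact (hf.isUnit _ hreg).map _
  · refine (injective_iff_map_eq_zero g).2 fun x hx => ?_
    obtain ⟨x, rfl⟩ := Ideal.Quotient.mk_surjective x
    rw [hg, mk_one_sub_eq_zero_iff hee', ← he', ← map_mul] at hx
    exact (mk_one_sub_eq_zero_iff he).2 (hf.injective (hx.trans (map_zero f).symm))
  · obtain ⟨t, rfl⟩ := Ideal.Quotient.mk_surjective t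
    obtain ⟨s, hs, r, h⟩ := hf.exists_mul_eq t
    refine ⟨Ideal.Quotient.mk _ s, ⟨fun x hx => ?_, fun x hx => ?_⟩, Ideal.Quotient.mk _ r, ?_⟩
    · obtain ⟨x, rfl⟩ := Ideal.Quotient.mk_surjective x
      rw [← map_mul, mk_one_sub_eq_zero_iff he, mul_assoc] at hx
      exact (mk_one_sub_eq_zero_iff he).2 (hs.1 _ hx)
    · obtain ⟨x, rfl⟩ := Ideal.Quotient.mk_surjective x
      rw [← map_mul, mk_one_sub_eq_zero_iff he, mul_assoc, hc, ← mul_assoc] at hx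
      exact (mk_one_sub_eq_zero_iff he).2 (hs.2 _ hx)
    · rw [hg, hg, ← map_mul, h]

end QuotientMaps

/-! ### Prime ideals, m-sequences and the elementwise form of semiprimeness. -/

section PrimeIdeals

variable {R : Type*} [Ring R]

/-- A two-sided ideal avoiding an `m`-sequence is contained in a prime ideal avoiding it. -/
theorem exists_isPrimeIdeal_ge (a : ℕ → R) (ha : ∀ n, ∃ r, a (n + 1) = a n * r * a n)
    {I : Ideal R} (hI : I.IsTwoSided) (haI : ∀ n, a n ∉ I) :
    ∃ P, IsPrimeIdeal P ∧ I ≤ P ∧ ∀ n, a n ∉ P := by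
  obtain ⟨P, hIP, hP⟩ := zorn_le_nonempty₀ {P : Ideal R | P.IsTwoSided ∧ ∀ n, a n ∉ P}
    (fun c hc hchain y hy => by
      have hdir : DirectedOn (· ≤ ·) c := hchain.directedOn
      have hne : c.Nonempty := ⟨y, hy⟩
      refine ⟨sSup c, ⟨⟨fun b hx => ?_⟩, fun n hn => ?_⟩, fun z hz => le_sSup hz⟩
      · obtain ⟨Q, hQ, hxQ⟩ := (Submodule.mem_sSup_of_directed hne hdir).1 hx
        exact (Submodule.mem_sSup_of_directed hne hdir).2
          ⟨Q, hQ, (hc hQ).1.mul_mem_of_left b hxQ⟩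
      · obtain ⟨Q, hQ, hxQ⟩ := (Submodule.mem_sSup_of_directed hne hdir).1 hn
        exact (hc hQ).2 n hxQ) I ⟨hI, haI⟩
  have hmono : ∀ {J : Ideal R}, J.IsTwoSided → ∀ {m n}, m ≤ n → a m ∈ J → a n ∈ J := by
    intro J hJ m n hmn hm
    induction n, hmn using Nat.le_induction with
    | base => exact hm
    | succ k _ ih =>
      obtain ⟨r, hr⟩ := ha k
      rw [hr, mul_assoc]
      exact hJ.mul_mem_of_left _ ih
  have hmeet : ∀ J : Ideal R, J.IsTwoSided → ¬ J ≤ P → (P ⊔ J).IsTwoSided ∧ ∃ n, a n ∈ P ⊔ J := by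
    intro J hJ hJP
    have h2 : (P ⊔ J).IsTwoSided := ⟨fun b hx => by
      obtain ⟨p, hp, j, hj, rfl⟩ := Submodule.mem_sup.1 hx
      rw [add_mul]
      exact Submodule.add_mem_sup (hP.1.1.mul_mem_of_left b hp) (hJ.mul_mem_of_left b hj)⟩
    refine ⟨h2, ?_⟩
    by_contra! hcon
    exact hJP (le_sup_right.trans (hP.2 ⟨h2, hcon⟩ le_sup_left))
  refine ⟨P, ⟨hP.1.1, fun htop => hP.1.2 0 (htop ▸ Submodule.mem_top), fun J K hJ hK hJK => ?_⟩,
    hIP, hP.1.2⟩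
  -- By maximality the sequence enters both `P ⊔ J` and `P ⊔ K`. At a common index, `a * r * a` lies
  -- in `P + J * K ≤ P`, although it is the next term.
  by_contra! hcon
  obtain ⟨hJ2, i, hi⟩ := hmeet J hJ hcon.1
  obtain ⟨hK2, j, hj⟩ := hmeet K hK hcon.2
  have hi' := hmono hJ2 (le_max_left i j) hi
  have hj' := hmono hK2 (le_max_right i j) hj
  obtain ⟨r, hr⟩ := ha (max i j)
  refine hP.1.2 (max i j + 1) ?_
  obtain ⟨p, hp, x, hx, hpx⟩ := Submodule.mem_sup.1 hi'
  obtain ⟨q, hq, y, hy, hqy⟩ := Submodule.mem_sup.1 hj'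
  rw [hr]
  nth_rw 1 [← hpx]
  rw [← hqy]
  have hP2 := hP.1.1
  have h1 : x * r * y ∈ P := hJK (Ideal.mul_mem_mul (hJ.mul_mem_of_left r hx) hy)
  have h2 : (p + x) * r * (q + y) = p * (r * (q + y)) + (x * r) * q + x * r * y := by noncomm_ring
  rw [h2]
  exact P.add_mem (P.add_mem (hP2.mul_mem_of_left _ hp) (P.mul_mem_left _ hq)) h1

theorem exists_isPrimeIdeal_ge_of_ne_top {I : Ideal R} (hI : I.IsTwoSided) (hne : I ≠ ⊤) :
    ∃ P, IsPrimeIdeal P ∧ I ≤ P := by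
  obtain ⟨P, hP, hIP, -⟩ := exists_isPrimeIdeal_ge (fun _ => (1 : R)) (fun _ => ⟨1, by simp⟩) hI
    fun _ h => hne ((Ideal.eq_top_iff_one I).2 h)
  exact ⟨P, hP, hIP⟩

theorem isPrimeIdeal_sInf_of_isChain {c : Set (Ideal R)} (hc : ∀ P ∈ c, IsPrimeIdeal P)
    (hchain : IsChain (· ≤ ·) c) (hne : c.Nonempty) : IsPrimeIdeal (sInf c) := by
  refine ⟨⟨fun b hx => ?_⟩, fun htop => ?_, fun I J hI hJ hIJ => ?_⟩
  · simp only [Submodule.mem_sInf] at hx ⊢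
    exact fun Q hQ => (hc Q hQ).isTwoSided.mul_mem_of_left b (hx Q hQ)
  · obtain ⟨y, hy⟩ := hne
    exact (hc y hy).ne_top (top_le_iff.1 (htop.ge.trans (sInf_le hy)))
  · by_contra! hcon
    simp only [le_sInf_iff, not_forall] at hcon
    obtain ⟨⟨P₁, h₁, hI₁⟩, P₂, h₂, hJ₂⟩ := hcon
    have hle : ∀ P ∈ c, I * J ≤ P := fun P hP => hIJ.trans (sInf_le hP)
    rcases hchain.total h₁ h₂ with h | h
    · exact ((hc _ h₁).le_or_le I J hI hJ (hle _ h₁)).elim hI₁ (fun h' => hJ₂ (h'.trans h))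
    · exact ((hc _ h₂).le_or_le I J hI hJ (hle _ h₂)).elim (fun h' => hI₁ (h'.trans h)) hJ₂

theorem exists_minPrimes_le {P : Ideal R} (hP : IsPrimeIdeal P) : ∃ Q ∈ minPrimes R, Q ≤ P := by
  obtain ⟨Q, hQP, hQ⟩ := zorn_le_nonempty₀ (α := (Ideal R)ᵒᵈ) {P | IsPrimeIdeal (R := R) P}
    (fun c hc hchain y hy => ⟨(sInf (α := Ideal R) c :),
      isPrimeIdeal_sInf_of_isChain hc hchain.symm ⟨y, hy⟩,
      fun z hz => sInf_le (α := Ideal R) hz⟩) P hP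
  exact ⟨Q, ⟨hQ.1, fun Q' hQ' h => hQ.2 hQ' h⟩, hQP⟩

theorem IsPrimeIdeal.mem_or_mem {P : Ideal R} (hP : IsPrimeIdeal P) {a b : R}
    (h : ∀ r, a * r * b ∈ P) : a ∈ P ∨ b ∈ P := by
  have hts : ∀ x : R, (Ideal.span {x} * ⊤ : Ideal R).IsTwoSided := fun x => inferInstance
  have hmem : ∀ x : R, x ∈ (Ideal.span {x} * ⊤ : Ideal R) := fun x => by
    simpa using Ideal.mul_mem_mul (Ideal.mem_span_singleton_self x)
      (Submodule.mem_top (R := R) (x := (1 : R)))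
  refine (hP.le_or_le _ _ (hts a) (hts b) ?_).imp (fun h => h (hmem a)) (fun h => h (hmem b))
  have hP2 := hP.isTwoSided
  rw [Ideal.mul_le]
  intro x hx y hy
  have hy' : ∀ r, a * r * y ∈ P := by
    refine fun r => Submodule.smul_induction_on (p := fun y => ∀ r, a * r * y ∈ P) hy ?_ ?_ r
    · intro m hm n _ r
      obtain ⟨c, rfl⟩ := Ideal.mem_span_singleton'.1 hm
      have := hP2.mul_mem_of_left n (h (r * c))
      simpa [mul_assoc] using this
    · intro y z hy hz r
      rw [mul_add]
      exact P.add_mem (hy r) (hz r)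
  refine Submodule.smul_induction_on (p := fun x => x * y ∈ P) hx ?_ ?_
  · intro m hm n _
    obtain ⟨c, rfl⟩ := Ideal.mem_span_singleton'.1 hm
    have := P.mul_mem_left c (hy' n)
    simpa [mul_assoc] using this
  · intro y z hy hz
    rw [add_mul]
    exact P.add_mem hy hz

/-- If `x ≠ 0`, choosing nonzero elements `a * r * a` repeatedly starts an m-sequence at `x` that
avoids `0`, and some prime then misses `x`. -/
theorem isSemiprimeRing_iff :
    IsSemiprimeRing R ↔ ∀ a : R, (∀ r, a * r * a = 0) → a = 0 := by
  constructor
  · intro h a ha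
    rw [← Ideal.mem_bot, ← (h : primeRadical R = ⊥), primeRadical, Submodule.mem_sInf]
    exact fun P hP => (hP.mem_or_mem fun r => by rw [ha r]; exact P.zero_mem).elim id id
  · intro h
    refine (Submodule.eq_bot_iff _).2 fun x hx => ?_
    by_contra hx0
    have hstep : ∀ a : {a : R // a ≠ 0}, ∃ b : {a : R // a ≠ 0}, ∃ r, (b : R) = a * r * a := by
      intro a
      by_contra! hcon
      exact a.2 (h a fun r => by_contra fun hr => hcon ⟨_, hr⟩ r rfl)
    choose g hg using hstep
    let a : ℕ → {a : R // a ≠ 0} := fun n => g^[n] ⟨x, hx0⟩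
    obtain ⟨P, hP, -, hPa⟩ := exists_isPrimeIdeal_ge (fun n => (a n : R)) (fun n => by
      simp only [a, Function.iterate_succ_apply']
      exact hg _) (I := ⊥) inferInstance fun n => (a n).2
    exact hPa 0 (Submodule.mem_sInf.1 hx P hP)

end PrimeIdeals

/-! ### Goldie's theorem: regular elements in essential left ideals. -/

section Goldie

variable {R : Type*} [Ring R]

theorem mem_leftAnnihilator_singleton {x a : R} : x ∈ leftAnnihilator {a} ↔ x * a = 0 :=
  ⟨fun h => h a rfl, fun h _ hy => by rw [Set.mem_singleton_iff.1 hy, h]⟩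

/-- An essential left ideal: one that meets every nonzero left ideal nontrivially. -/
def IsEssential (E : Ideal R) : Prop :=
  ∀ x ≠ 0, ∃ r, r * x ≠ 0 ∧ r * x ∈ E

theorem IsEssential.mono {E F : Ideal R} (hE : IsEssential E) (h : E ≤ F) : IsEssential F :=
  fun x hx => (hE x hx).imp fun _ hr => ⟨hr.1, h hr.2⟩

theorem IsEssential.comap_mulRight {E : Ideal R} (hE : IsEssential E) (a : R) :
    IsEssential (Submodule.comap (LinearMap.toSpanSingleton R R a) E) := by
  intro x hx
  by_cases h : x * a = 0
  · exact ⟨1, by rwa [one_mul], by simp [h]⟩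
  · obtain ⟨r, hr0, hr⟩ := hE _ h
    rw [← mul_assoc] at hr0 hr
    exact ⟨r, left_ne_zero_of_mul hr0, by simpa using hr⟩

/-- Take `K` maximal among left ideals disjoint from `J`: if `R x` met `K ⊔ J` trivially, `K ⊔ R x`
would still be disjoint from `J`. -/
theorem exists_disjoint_isEssential_sup (J : Ideal R) :
    ∃ K : Ideal R, Disjoint K J ∧ IsEssential (K ⊔ J) := by
  obtain ⟨K, -, hK⟩ := zorn_le_nonempty₀ {K : Ideal R | Disjoint K J}
    (fun c hc hchain y hy => by
      refine ⟨sSup c, Submodule.disjoint_def.2 fun x hx hxJ => ?_, fun z hz => le_sSup hz⟩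
      obtain ⟨Q, hQ, hxQ⟩ := (Submodule.mem_sSup_of_directed ⟨y, hy⟩ hchain.directedOn).1 hx
      exact Submodule.disjoint_def.1 (hc hQ) x hxQ hxJ) ⊥ disjoint_bot_left
  refine ⟨K, hK.1, fun x hx => ?_⟩
  by_contra! hcon
  have hcon' : ∀ r, r * x ∈ K ⊔ J → r * x = 0 := fun r h => by_contra fun h0 => hcon r h0 h
  have hdis : Disjoint (K ⊔ Ideal.span {x}) J := by
    refine Submodule.disjoint_def.2 fun y hy hyJ => ?_
    obtain ⟨k, hk, z, hz, rfl⟩ := Submodule.mem_sup.1 hy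
    obtain ⟨r, rfl⟩ := Ideal.mem_span_singleton'.1 hz
    have h0 : r * x = 0 := hcon' r (by
      have := (K ⊔ J).sub_mem (Submodule.mem_sup_right hyJ) (Submodule.mem_sup_left hk)
      rwa [add_sub_cancel_left] at this)
    rw [h0, add_zero] at hyJ ⊢
    exact Submodule.disjoint_def.1 hK.1 k hk hyJ
  have hxK : x ∈ K := hK.2 hdis le_sup_left
    (Submodule.mem_sup_right (Ideal.mem_span_singleton_self x))
  have := hcon' 1 (by rw [one_mul]; exact Submodule.mem_sup_left hxK)
  exact hx (by rwa [one_mul] at this)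

/-- In a vanishing sum, a nonzero term of least index `i` would be minus a sum of later terms, all
in `L (i + 1)`. -/
theorem iSupIndep_of_antitone {M : Type*} [AddCommGroup M] [Module R M] {I L : ℕ → Submodule R M}
    (hL : Antitone L) (hIL : ∀ n, I n ≤ L n) (hd : ∀ n, Disjoint (I n) (L (n + 1))) :
    iSupIndep I := by
  classical
  rw [iSupIndep_iff_finsetSum_eq_zero_imp_eq_zero]
  intro s v hv h0
  by_contra! hcon
  have hex : ∃ i, i ∈ s ∧ v i ≠ 0 := hcon
  obtain ⟨hi, hvi⟩ := Nat.find_spec hex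
  have hmin := fun j => Nat.find_min (m := j) hex
  set i := Nat.find hex
  refine hvi (Submodule.disjoint_def.1 (hd i) _ (hv i hi) ?_)
  rw [← Finset.add_sum_erase s v hi] at h0
  rw [eq_neg_of_add_eq_zero_left h0]
  refine Submodule.neg_mem _ (Submodule.sum_mem _ fun j hj => ?_)
  obtain ⟨hji, hjs⟩ := Finset.mem_erase.1 hj
  rcases lt_or_gt_of_ne hji with h | h
  · have : v j = 0 := by_contra fun hne => hmin j h ⟨hjs, hne⟩
    rw [this]
    exact Submodule.zero_mem _
  · exact hL h (hIL j (hv j hjs))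

namespace IsLeftGoldie

theorem not_antitone (hR : IsLeftGoldie R) {I L : ℕ → Ideal R} (hL : Antitone L)
    (hIL : ∀ n, I n ≤ L n) (hd : ∀ n, Disjoint (I n) (L (n + 1))) (hI : ∀ n, I n ≠ ⊥) : False :=
  hR.finite_rank ⟨I, hI, iSupIndep_of_antitone hL hIL hd⟩

theorem exists_maximal_leftAnnihilator (hR : IsLeftGoldie R) {S : Set R} (hS : S.Nonempty) :
    ∃ a ∈ S, ∀ b ∈ S, leftAnnihilator {a} ≤ leftAnnihilator {b} →
      leftAnnihilator {b} ≤ leftAnnihilator {a} := by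
  by_contra! hcon
  obtain ⟨x, hx⟩ := hS
  choose g hgS hg hg' using fun a : S => hcon a a.2
  let a : ℕ → S := fun n => (fun b : S => (⟨g b, hgS b⟩ : S))^[n] ⟨x, hx⟩
  have ha : ∀ n, (a (n + 1) : R) = g (a n) := fun n => by
    simp only [a, Function.iterate_succ_apply']
  obtain ⟨n, hn⟩ := hR.acc_leftAnnihilator (fun n => {(a n : R)})
    (monotone_nat_of_le_succ fun n => by rw [ha]; exact hg _)
  have := hn (n + 1) n.le_succ
  rw [ha] at this
  exact hg' _ this.le

theorem exists_leftAnnihilator_pow (hR : IsLeftGoldie R) (a : R) :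
    ∃ n, ∀ x, x * a ^ (n + 1) * a ^ (n + 1) = 0 → x * a ^ (n + 1) = 0 := by
  obtain ⟨n, hn⟩ := hR.acc_leftAnnihilator (fun n => {a ^ (n + 1)})
    (monotone_nat_of_le_succ fun n x hx => by
      rw [mem_leftAnnihilator_singleton] at hx ⊢
      rw [pow_succ, ← mul_assoc, hx, zero_mul])
  refine ⟨n, fun x hx => ?_⟩
  -- The exponents are shifted by one, so index `2 * n + 1` is the square of `a ^ (n + 1)`.
  rw [← mem_leftAnnihilator_singleton, ← hn (2 * n + 1) (by omega),
    mem_leftAnnihilator_singleton, ← hx, mul_assoc, ← pow_add]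
  congr 2
  omega

/-- A semiprime left Goldie ring has no nonzero nil right ideals. -/
theorem eq_zero_of_forall_isNilpotent (hR : IsLeftGoldie R)
    (hsp : ∀ a : R, (∀ r, a * r * a = 0) → a = 0) {a : R} (ha : ∀ r, IsNilpotent (a * r)) :
    a = 0 := by
  by_contra ha0
  obtain ⟨b, ⟨hb0, hb⟩, hmax⟩ := hR.exists_maximal_leftAnnihilator
    (S := {b | b ≠ 0 ∧ ∀ r, IsNilpotent (b * r)}) ⟨a, ha0, ha⟩
  refine hb0 (hsp b fun u => ?_)
  by_cases hbu : b * u = 0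
  · rw [hbu, zero_mul]
  classical
  have hn := Nat.find_spec (hb u)
  have hmin := fun m => Nat.find_min (m := m) (hb u)
  set n := Nat.find (hb u)
  obtain ⟨k, h0 | hk⟩ : ∃ k, n = 0 ∨ n = k + 1 := ⟨n - 1, by omega⟩
  · rw [h0, pow_zero] at hn
    exact absurd (by rw [← mul_one (b * u), hn, mul_zero]) hbu
  · rcases k with _ | j
    · rw [hk] at hn
      exact absurd (by simpa using hn) hbu
    have hne : (b * u) ^ (j + 1) ≠ 0 := hmin _ (by omega)
    have heq : (b * u) ^ (j + 1) = b * (u * (b * u) ^ j) := by rw [pow_succ', mul_assoc]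
    -- The last nonzero power of `b * u` is a right multiple of `b`, so by maximality it has the
    -- same left annihilator. As `b * u` kills it, `b * u * b = 0`.
    have := hmax _ ⟨hne, fun r => by rw [heq, mul_assoc]; exact hb _⟩ fun x hx => by
      rw [mem_leftAnnihilator_singleton] at hx ⊢
      rw [heq, ← mul_assoc, hx, zero_mul]
    have hmem : b * u ∈ leftAnnihilator {(b * u) ^ (j + 1)} := by
      rw [mem_leftAnnihilator_singleton, ← pow_succ', ← hk, hn]
    exact mem_leftAnnihilator_singleton.1 (this hmem)

theorem exists_mem_ne_zero_of_ne_bot (hR : IsLeftGoldie R)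
    (hsp : ∀ a : R, (∀ r, a * r * a = 0) → a = 0) {L : Ideal R} (hL : L ≠ ⊥) :
    ∃ a ∈ L, a ≠ 0 ∧ ∀ x, x * a * a = 0 → x * a = 0 := by
  obtain ⟨x, hx, hx0⟩ := Submodule.exists_mem_ne_zero_of_ne_bot hL
  have hnn : ∃ r, ¬ IsNilpotent (r * x) := by
    by_contra! hcon
    refine hx0 (hR.eq_zero_of_forall_isNilpotent hsp fun r => ?_)
    obtain ⟨n, hn⟩ := hcon r
    refine ⟨n + 1, ?_⟩
    have : ∀ m, (x * r) ^ (m + 1) = x * (r * x) ^ m * r := by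
      intro m
      induction m with
      | zero => simp
      | succ m ih => rw [pow_succ, ih, pow_succ]; simp only [mul_assoc]
    rw [this, hn, mul_zero, zero_mul]
  obtain ⟨r, hr⟩ := hnn
  obtain ⟨n, hn⟩ := hR.exists_leftAnnihilator_pow (r * x)
  refine ⟨(r * x) ^ (n + 1), ?_, fun h => hr ⟨_, h⟩, hn⟩
  rw [pow_succ]
  exact L.mul_mem_left _ (L.mul_mem_left _ hx)

/-- While `c ∈ E` has a nonzero left annihilator, add to it some `a` in `E` with `a * c = 0`.
Keeping `c` and `a` with the same left annihilators as their squares makes that of `c + a` the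
intersection of theirs, so the left ideals `R a` are independent and the process must stop. -/
theorem exists_mem_leftRegular (hR : IsLeftGoldie R)
    (hsp : ∀ a : R, (∀ r, a * r * a = 0) → a = 0) {E : Ideal R} (hE : IsEssential E) :
    ∃ c ∈ E, ∀ y, y * c = 0 → y = 0 := by
  by_contra! hcon
  let G := {c : R // c ∈ E ∧ ∀ y, y * c * c = 0 → y * c = 0}
  have hstep : ∀ c : G, ∃ a : R, a ≠ 0 ∧ a * c = 0 ∧ ∃ d : G,
      leftAnnihilator {(d : R)} ≤ leftAnnihilator {(c : R)} ∧
      Disjoint (Ideal.span {a}) (leftAnnihilator {(d : R)}) := by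
    rintro ⟨c, hcE, hc⟩
    obtain ⟨y, hy, hy0⟩ := hcon c hcE
    obtain ⟨r, hr0, hr⟩ := hE y hy0
    have hne : E ⊓ leftAnnihilator {c} ≠ ⊥ := Submodule.ne_bot_iff _ |>.2
      ⟨r * y, ⟨hr, mem_leftAnnihilator_singleton.2 (by rw [mul_assoc, hy, mul_zero])⟩, hr0⟩
    obtain ⟨a, ⟨haE, hac⟩, ha0, ha⟩ := hR.exists_mem_ne_zero_of_ne_bot hsp hne
    replace hac : a * c = 0 := mem_leftAnnihilator_singleton.1 hac
    have key : ∀ y, y * (c + a) = 0 → y * c = 0 ∧ y * a = 0 := by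
      intro y hy
      have h1 : y * c = 0 := hc y (by
        have : y * (c + a) * c = y * c * c + y * (a * c) := by noncomm_ring
        rwa [hy, zero_mul, hac, mul_zero, add_zero, eq_comm] at this)
      exact ⟨h1, by rwa [mul_add, h1, zero_add] at hy⟩
    refine ⟨a, ha0, hac, ⟨c + a, E.add_mem hcE haE, fun y hy => ?_⟩, fun y hy => ?_, ?_⟩
    · obtain ⟨h1, h2⟩ := key _ hy
      have h3 : y * c = 0 := hc y (by
        have : y * (c + a) * c = y * c * c + y * (a * c) := by noncomm_ring
        rwa [h1, hac, mul_zero, add_zero, eq_comm] at this)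
      have h4 : y * a = 0 := ha y (by
        have : y * (c + a) * a = y * c * a + y * a * a := by noncomm_ring
        rwa [h2, h3, zero_mul, zero_add, eq_comm] at this)
      rw [mul_add, h3, h4, add_zero]
    · rw [mem_leftAnnihilator_singleton] at hy ⊢
      exact (key y hy).1
    · refine Submodule.disjoint_def.2 fun y hy hy' => ?_
      obtain ⟨r, rfl⟩ := Ideal.mem_span_singleton'.1 hy
      exact ha r (key _ (mem_leftAnnihilator_singleton.1 hy')).2
  choose α hα0 hα g hg hd using hstep
  let c : ℕ → G := fun n => g^[n] ⟨0, E.zero_mem, by simp⟩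
  have hc : ∀ n, c (n + 1) = g (c n) := fun n => by simp only [c, Function.iterate_succ_apply']
  refine hR.not_antitone (I := fun n => Ideal.span {α (c n)})
    (L := fun n => leftAnnihilator {(c n : R)}) (antitone_nat_of_succ_le fun n => ?_)
    (fun n => ?_) (fun n => ?_) (fun n => ?_)
  · rw [hc]; exact hg _
  · rw [Ideal.span_singleton_le_iff_mem, mem_leftAnnihilator_singleton]; exact hα _
  · rw [hc]; exact hd _
  · rw [Ne, Ideal.span_singleton_eq_bot]; exact hα0 _

/-- If `R x` met `R s` trivially, the left ideals `R x s ^ n` would form an infinite direct sum. -/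
theorem isEssential_span_singleton (hR : IsLeftGoldie R) {s : R} (hs : ∀ y, y * s = 0 → y = 0) :
    IsEssential (Ideal.span {s}) := by
  intro x hx
  by_contra! hcon
  have hpow : ∀ n y, y * s ^ n = 0 → y = 0 := by
    intro n
    induction n with
    | zero => intro y hy; simpa using hy
    | succ n ih =>
      intro y hy
      rw [pow_succ, ← mul_assoc] at hy
      exact ih y (hs _ hy)
  refine hR.not_antitone (I := fun n => Ideal.span {x * s ^ n})
    (L := fun n => Ideal.span {s ^ n}) (antitone_nat_of_succ_le fun n => ?_)
    (fun n => ?_) (fun n => ?_) (fun n => ?_)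
  · rw [Ideal.span_singleton_le_iff_mem, pow_succ']
    exact Ideal.mul_mem_left _ _ (Ideal.mem_span_singleton_self _)
  · rw [Ideal.span_singleton_le_iff_mem]
    exact Ideal.mul_mem_left _ _ (Ideal.mem_span_singleton_self _)
  · refine Submodule.disjoint_def.2 fun y hy hy' => ?_
    obtain ⟨r, rfl⟩ := Ideal.mem_span_singleton'.1 hy
    obtain ⟨t, ht⟩ := Ideal.mem_span_singleton'.1 hy'
    have h1 : t * s = r * x := sub_eq_zero.1 (hpow n _ (by
      rw [sub_mul, mul_assoc, ← pow_succ', ht, mul_assoc, sub_self]))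
    have h2 : r * x = 0 := by_contra fun h0 =>
      hcon r h0 (Ideal.mem_span_singleton'.2 ⟨t, h1⟩)
    rw [← mul_assoc, h2, zero_mul]
  · rw [Ne, Ideal.span_singleton_eq_bot]
    exact fun h => hx (hpow n x h)

/-- The left singular ideal of a semiprime left Goldie ring is zero. -/
theorem eq_zero_of_isEssential_leftAnnihilator (hR : IsLeftGoldie R)
    (hsp : ∀ a : R, (∀ r, a * r * a = 0) → a = 0) {x : R}
    (hx : IsEssential (leftAnnihilator {x})) : x = 0 := by
  refine hR.eq_zero_of_forall_isNilpotent hsp fun r => ?_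
  obtain ⟨n, hn⟩ := hR.exists_leftAnnihilator_pow (x * r)
  refine ⟨n + 1, by_contra fun h0 => ?_⟩
  -- Here `t * (x * r) ^ (n + 1)` is nonzero but kills `x`, hence kills `(x * r) ^ (n + 1)`, against
  -- the choice of `n`.
  obtain ⟨t, ht0, ht⟩ := hx _ h0
  refine ht0 (hn t ?_)
  rw [mem_leftAnnihilator_singleton] at ht
  rw [pow_succ' (x * r) n] at ht ⊢
  rw [mul_assoc x r, ← mul_assoc _ x, ← mul_assoc x r, ht, zero_mul]

/-- One-sided regularity suffices: if `c * x = 0`, the left annihilator of `x` contains the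
essential ideal `R c`, so `x = 0`. -/
theorem exists_mem_nonZeroDivisors (hR : IsLeftGoldie R)
    (hsp : ∀ a : R, (∀ r, a * r * a = 0) → a = 0) {E : Ideal R} (hE : IsEssential E) :
    ∃ c ∈ E, c ∈ R⁰ := by
  obtain ⟨c, hcE, hc⟩ := hR.exists_mem_leftRegular hsp hE
  refine ⟨c, hcE, fun x hx => ?_, hc⟩
  refine hR.eq_zero_of_isEssential_leftAnnihilator hsp
    ((hR.isEssential_span_singleton hc).mono ?_)
  rwa [Ideal.span_singleton_le_iff_mem, mem_leftAnnihilator_singleton]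

theorem hasLeftQuotientRing (hR : IsLeftGoldie R)
    (hsp : ∀ a : R, (∀ r, a * r * a = 0) → a = 0) : HasLeftQuotientRing R := by
  intro r s
  obtain ⟨c, hc, hreg⟩ := hR.exists_mem_nonZeroDivisors hsp
    ((hR.isEssential_span_singleton s.2.2).comap_mulRight r)
  obtain ⟨t, ht⟩ := Ideal.mem_span_singleton'.1 (Submodule.mem_comap.1 hc)
  exact ⟨t, ⟨c, hreg⟩, by simpa using ht.symm⟩

end IsLeftGoldie

/-! ### Transfer of semisimplicity and chain conditions along a quotient map. -/

namespace IsLeftQuotientMap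

variable {T : Type*} [Ring T] {f : R →+* T}

theorem exists_mul_eq_of_mem_map (hf : IsLeftQuotientMap f) {I : Ideal R} {t : T}
    (ht : t ∈ I.map f) : ∃ s ∈ R⁰, ∃ r ∈ I, f s * t = f r := by
  induction ht using Submodule.span_induction with
  | mem x hx =>
    obtain ⟨r, hr, rfl⟩ := hx
    exact ⟨1, one_mem _, r, hr, by rw [map_one, one_mul]⟩
  | zero => exact ⟨1, one_mem _, 0, I.zero_mem, by simp⟩
  | add x y _ _ hx hy =>
    obtain ⟨s, hs, r, hr, h⟩ := hx
    obtain ⟨s', hs', r', hr', h'⟩ := hy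
    obtain ⟨u, v, huv⟩ := hf.hasLeftQuotientRing s ⟨s', hs'⟩
    refine ⟨v * s, mul_mem v.2 hs, v * r + u * r',
      I.add_mem (I.mul_mem_left _ hr) (I.mul_mem_left _ hr'), ?_⟩
    rw [mul_add, map_add]
    congr 1
    · rw [map_mul, mul_assoc, h, map_mul]
    · rw [huv, map_mul, mul_assoc, h', map_mul]
  | smul a x _ hx =>
    obtain ⟨s, hs, r, hr, h⟩ := hx
    obtain ⟨w, hw⟩ := hf.isUnit s hs
    obtain ⟨s', hs', r', h'⟩ := hf.exists_mul_eq (a * ↑w⁻¹)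
    refine ⟨s', hs', r' * r, I.mul_mem_left _ hr, ?_⟩
    rw [map_mul, ← h, ← h', ← hw, smul_eq_mul]
    simp only [mul_assoc, Units.inv_mul_cancel_left]

/-- The complement of `J` is extended from a left ideal `K` whose sum with the contraction of `J` is
essential; a regular element of that sum becomes a unit. -/
theorem isSemisimpleRing (hf : IsLeftQuotientMap f)
    (hreg : ∀ E : Ideal R, IsEssential E → ∃ c ∈ E, c ∈ R⁰) : IsSemisimpleRing T := by
  refine (isSemisimpleModule_iff T T).2 ⟨fun J => ?_⟩
  obtain ⟨K, hKJ, hK⟩ := exists_disjoint_isEssential_sup (Ideal.comap f J)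
  obtain ⟨s, hs, hsreg⟩ := hreg _ hK
  refine ⟨K.map f, IsCompl.symm ⟨Submodule.disjoint_def.2 fun t ht htJ => ?_, ?_⟩⟩
  · obtain ⟨s, hs, k, hk, h⟩ := hf.exists_mul_eq_of_mem_map ht
    have hk0 : k = 0 := Submodule.disjoint_def.1 hKJ k hk (by
      rw [Ideal.mem_comap, ← h]
      exact Ideal.mul_mem_left J _ htJ)
    rwa [hk0, map_zero, (hf.isUnit s hs).mul_right_eq_zero] at h
  · rw [codisjoint_iff]
    refine Ideal.eq_top_of_isUnit_mem _ ?_ (hf.isUnit s hsreg)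
    obtain ⟨k, hk, j, hj, rfl⟩ := Submodule.mem_sup.1 hs
    rw [map_add]
    exact Submodule.add_mem_sup (Ideal.mem_map_of_mem f hk) hj

theorem exists_mem_nonZeroDivisors_of_isEssential [IsSemisimpleRing T] (hf : IsLeftQuotientMap f)
    {E : Ideal R} (hE : IsEssential E) : ∃ c ∈ E, c ∈ R⁰ := by
  obtain ⟨J, hJ⟩ := exists_isCompl (E.map f)
  -- Clearing denominators in a nonzero element of `J` would give one of `R`, with a nonzero
  -- multiple in `E`.
  have hJ0 : J = ⊥ := by
    refine (Submodule.eq_bot_iff _).2 fun t ht => by_contra fun ht0 => ?_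
    obtain ⟨s, hs, r, h⟩ := hf.exists_mul_eq t
    have hr0 : r ≠ 0 := by
      rintro rfl
      rw [map_zero, (hf.isUnit s hs).mul_right_eq_zero] at h
      exact ht0 h
    obtain ⟨u, hu0, hu⟩ := hE r hr0
    refine hu0 (hf.injective ?_)
    rw [map_zero]
    refine Submodule.disjoint_def.1 hJ.disjoint _ (Ideal.mem_map_of_mem f hu) ?_
    rw [map_mul, ← h]
    exact Ideal.mul_mem_left J _ (Ideal.mul_mem_left J _ ht)
  have h1 : (1 : T) ∈ E.map f := by
    have := hJ.sup_eq_top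
    rw [hJ0, sup_bot_eq] at this
    rw [this]
    exact Submodule.mem_top
  obtain ⟨s, hs, r, hr, h⟩ := hf.exists_mul_eq_of_mem_map h1
  rw [mul_one] at h
  exact ⟨s, hf.injective h ▸ hr, hs⟩

theorem eq_zero_of_forall_mul_mul_eq_zero [IsSemisimpleRing T] (hf : IsLeftQuotientMap f) {a : R}
    (ha : ∀ r, a * r * a = 0) : a = 0 := by
  let E : Ideal R :=
    { carrier := {x | ∀ r, a * r * x = 0}
      zero_mem' := fun r => mul_zero _
      add_mem' := fun hx hy r => by rw [mul_add, hx r, hy r, add_zero]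
      smul_mem' := fun c x hx r => by
        rw [smul_eq_mul, ← mul_assoc, mul_assoc a r c]
        exact hx _ }
  -- Either `x` is in `E`, or some `a * r * x ≠ 0` is, because `a R a = 0`.
  have hE : IsEssential E := by
    intro x hx
    by_cases h : ∀ r, a * r * x = 0
    · exact ⟨1, by rwa [one_mul], by rw [one_mul]; exact h⟩
    · push Not at h
      obtain ⟨r, hr⟩ := h
      exact ⟨a * r, hr, fun u => by rw [← mul_assoc, ← mul_assoc, ha u, zero_mul, zero_mul]⟩
  obtain ⟨s, hs, hsreg⟩ := hf.exists_mem_nonZeroDivisors_of_isEssential hE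
  have := hs 1
  rw [mul_one] at this
  exact hsreg.2 _ this

theorem isLeftGoldie [IsNoetherianRing T] (hf : IsLeftQuotientMap f) : IsLeftGoldie R := by
  refine ⟨?_, fun X hX => ?_⟩
  · rintro ⟨I, hI, hind⟩
    let L : ℕ → Ideal R := fun n => ⨆ i : Finset.range n, I i
    have hL : ∀ n, Disjoint (I n) (L n) := fun n => (hind n).mono_right
      (iSup_le fun i => le_iSup₂_of_le (i : ℕ) (Finset.mem_range.1 i.2).ne le_rfl)
    have hmono : Monotone L := fun m n hmn => iSup_le fun i =>
      le_iSup_of_le ⟨i, Finset.mem_range.2 ((Finset.mem_range.1 i.2).trans_le hmn)⟩ le_rfl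
    have hIL : ∀ n, I n ≤ L (n + 1) := fun n =>
      le_iSup (fun i : Finset.range (n + 1) => I i) ⟨n, by simp⟩
    obtain ⟨n, hn⟩ := monotone_stabilizes_iff_noetherian.2 ‹IsNoetherianRing T›
      ⟨fun n => (L n).map f, fun m n hmn => Ideal.map_mono (hmono hmn)⟩
    obtain ⟨x, hx, hx0⟩ := Submodule.exists_mem_ne_zero_of_ne_bot (hI n)
    have hmem : f x ∈ (L n).map f := by
      have : (L n).map f = (L (n + 1)).map f := hn (n + 1) n.le_succ
      rw [this]
      exact Ideal.mem_map_of_mem f (hIL n hx)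
    obtain ⟨s, hs, r, hr, h⟩ := hf.exists_mul_eq_of_mem_map hmem
    rw [← map_mul] at h
    rw [← hf.injective h] at hr
    exact hx0 (hs.1 _ (Submodule.disjoint_def.1 (hL n) _ ((I n).mul_mem_left s hx) hr))
  -- Annihilators of the images of `X n` in `T` need not form a chain. The sets `Y n` decrease and
  -- have the same left annihilators in `R` as `X n`.
  · let Y : ℕ → Set R := fun n => ⋃ m ≥ n, X m
    have hY : ∀ n a, a ∈ leftAnnihilator (X n) ↔ f a ∈ leftAnnihilator (f '' Y n) := by
      refine fun n a => ⟨?_, fun h x hx => hf.injective ?_⟩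
      · rintro h _ ⟨x, hx, rfl⟩
        obtain ⟨m, hm, hxm⟩ := Set.mem_iUnion₂.1 hx
        rw [← map_mul, hX hm h x hxm, map_zero]
      · rw [map_mul, map_zero]
        exact h _ ⟨x, Set.mem_iUnion₂.2 ⟨n, le_rfl, hx⟩, rfl⟩
    obtain ⟨n, hn⟩ := monotone_stabilizes_iff_noetherian.2 ‹IsNoetherianRing T›
      ⟨fun n => leftAnnihilator (f '' Y n), fun m n hmn a ha x hx => ha x
        (Set.image_mono (Set.biUnion_mono (fun k hk => le_trans hmn hk) fun _ _ => le_rfl) hx)⟩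
    refine ⟨n, fun m hm => Ideal.ext fun a => ?_⟩
    have : leftAnnihilator (f '' Y n) = leftAnnihilator (f '' Y m) := hn m hm
    rw [hY, hY, this]

end IsLeftQuotientMap

end Goldie

/-! ### Decomposition along the central idempotents. -/

section Product

variable {R : Type*} [Ring R] {ι : Type*} [Fintype ι] {e : ι → Subring.center R}

theorem bijective_pi_mk_one_sub (he : CompleteOrthogonalIdempotents e) :
    Function.Bijective (RingHom.pi fun i =>
      Ideal.Quotient.mk (Ideal.span {((1 - e i : Subring.center R) : R)})) := by
  classical
  have hsum : ∑ i, (e i : R) = 1 := by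
    have := congrArg (Subring.center R).subtype he.complete
    rwa [map_sum, map_one] at this
  refine ⟨(injective_iff_map_eq_zero _).2 fun x hx => ?_, fun y => ?_⟩
  · rw [← mul_one x, ← hsum, Finset.mul_sum]
    exact Finset.sum_eq_zero fun i _ => (mk_one_sub_eq_zero_iff (he.idem i)).1 (congrFun hx i)
  · choose x hx using fun i => Ideal.Quotient.mk_surjective (y i)
    refine ⟨∑ i, x i * e i, funext fun j => ?_⟩
    rw [RingHom.pi_apply, ← hx j, ← sub_eq_zero, ← map_sub, mk_one_sub_eq_zero_iff (he.idem j),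
      sub_mul, Finset.sum_mul, Finset.sum_eq_single j, mul_assoc, ← Subring.coe_mul,
      (he.idem j).eq, sub_self]
    · intro i _ hij
      rw [mul_assoc, ← Subring.coe_mul, he.ortho hij, Subring.coe_zero, mul_zero]
    · simp

noncomputable def piFactorRingEquiv (he : CompleteOrthogonalIdempotents e) :
    R ≃+* ∀ i, FactorRing R (1 - e i) :=
  RingEquiv.ofBijective _ (bijective_pi_mk_one_sub he)

/-- Apply semiprimeness to `a * e`, since `(a * e) * r * (a * e) = (a * r * a) * e`. -/
theorem eq_zero_of_forall_mul_mul_eq_zero_factorRing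
    (hsp : ∀ a : R, (∀ r, a * r * a = 0) → a = 0) {e : Subring.center R} (he : e * e = e)
    (a : FactorRing R (1 - e)) (ha : ∀ r, a * r * a = 0) : a = 0 := by
  obtain ⟨a, rfl⟩ := Ideal.Quotient.mk_surjective a
  rw [mk_one_sub_eq_zero_iff he]
  have hc : ∀ x : R, x * e = e * x := Subring.mem_center_iff.1 e.2
  refine hsp _ fun r => ?_
  have h := ha (Ideal.Quotient.mk _ r)
  rw [← map_mul, ← map_mul, mk_one_sub_eq_zero_iff he] at h
  calc a * e * r * (a * e) = a * (e * r) * (a * e) := by rw [mul_assoc a]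
    _ = (a * r) * (e * a) * e := by rw [← hc r]; simp only [mul_assoc]
    _ = (a * r * a * e) * e := by rw [← hc a]; simp only [mul_assoc]
    _ = 0 := by rw [h, zero_mul]

theorem exists_isSemisimpleRing_iff (he : CompleteOrthogonalIdempotents e) :
    (∃ h : HasLeftQuotientRing R, IsSemisimpleRing (LeftQuotientRing R h)) ↔
      IsSemiprimeRing R ∧ ∀ i, IsLeftGoldie (FactorRing R (1 - e i)) := by
  constructor
  · rintro ⟨h, hss⟩
    have hf := isLeftQuotientMap_of h
    refine ⟨isSemiprimeRing_iff.2 fun a ha => hf.eq_zero_of_forall_mul_mul_eq_zero ha, fun i => ?_⟩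
    obtain ⟨g, hg⟩ := hf.factorRing (he.idem i) (e' := LeftQuotientRing.ofCenter R h (e i)) rfl
    have : IsSemisimpleRing
        (FactorRing (LeftQuotientRing R h) (1 - LeftQuotientRing.ofCenter R h (e i))) :=
      (Ideal.Quotient.mk _).isSemisimpleRing_of_surjective Ideal.Quotient.mk_surjective
    exact hg.isLeftGoldie
  · rintro ⟨hsp, hG⟩
    rw [isSemiprimeRing_iff] at hsp
    have hsp' := fun i => eq_zero_of_forall_mul_mul_eq_zero_factorRing hsp (he.idem i)
    have h' := fun i => (hG i).hasLeftQuotientRing (hsp' i)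
    have hss : ∀ i, IsSemisimpleRing (LeftQuotientRing _ (h' i)) := fun i =>
      (isLeftQuotientMap_of (h' i)).isSemisimpleRing fun _ hE =>
        (hG i).exists_mem_nonZeroDivisors (hsp' i) hE
    have hf := (IsLeftQuotientMap.piMap fun i => isLeftQuotientMap_of (h' i)).comp_ringEquiv
      (piFactorRingEquiv he)
    obtain ⟨σ⟩ := hf.nonempty_ringEquiv hf.hasLeftQuotientRing
    exact ⟨hf.hasLeftQuotientRing, σ.symm.isSemisimpleRing⟩

theorem exists_leftQuotientRing_equivs (he : CompleteOrthogonalIdempotents e)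
    (h : HasLeftQuotientRing R) :
    ∃ h' : ∀ i, HasLeftQuotientRing (FactorRing R (1 - e i)),
      Nonempty (LeftQuotientRing R h ≃+*
        (∀ i, LeftQuotientRing (FactorRing R (1 - e i)) (h' i))) ∧
      (∀ i, Nonempty (LeftQuotientRing (FactorRing R (1 - e i)) (h' i) ≃+*
        FactorRing (LeftQuotientRing R h) (LeftQuotientRing.ofCenter R h (1 - e i)))) := by
  have hc : ∀ i, LeftQuotientRing.ofCenter R h (1 - e i) =
      1 - LeftQuotientRing.ofCenter R h (e i) := fun i =>
    Subtype.ext (by simp [LeftQuotientRing.ofCenter])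
  choose g hg using fun i => (isLeftQuotientMap_of h).factorRing (he.idem i)
    (e' := LeftQuotientRing.ofCenter R h (e i)) rfl
  refine ⟨fun i => (hg i).hasLeftQuotientRing, ?_, fun i => ?_⟩
  · exact ((IsLeftQuotientMap.piMap fun i => isLeftQuotientMap_of
      (hg i).hasLeftQuotientRing).comp_ringEquiv (piFactorRingEquiv he)).nonempty_ringEquiv h
  · rw [hc]
    exact (hg i).nonempty_ringEquiv _

end Product

/-! ### Contraction of minimal primes to the centre. -/

section Center

variable {R : Type*} [Ring R]

theorem IsPrimeIdeal.comap_center {P : Ideal R} (hP : IsPrimeIdeal P) :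
    (P.comap (Subring.center R).subtype).IsPrime := by
  refine Ideal.isPrime_iff.2 ⟨fun h => hP.ne_top ?_, fun {x y} hxy => ?_⟩
  · rw [Ideal.eq_top_iff_one] at h ⊢
    simpa using h
  · refine hP.mem_or_mem fun r => ?_
    have hc : (x : R) * r = r * x := (Subring.mem_center_iff.1 x.2 r).symm
    change (x : R) * r * y ∈ P
    rw [hc, mul_assoc]
    exact P.mul_mem_left r hxy

theorem mapsTo_comap_center_minPrimes [Ring.KrullDimLE 0 (Subring.center R)] :
    Set.MapsTo (Ideal.comap (Subring.center R).subtype) (minPrimes R)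
      (minimalPrimes (Subring.center R)) := by
  intro P hP
  have := IsPrimeIdeal.comap_center (Minimal.prop hP)
  exact Ideal.mem_minimalPrimes_of_krullDimLE_zero _

theorem surjOn_comap_center_minPrimes {n : ℕ} {K : Fin n → Type*} [∀ i, Field (K i)]
    (φ : Subring.center R ≃+* (∀ i, K i)) [Ring.KrullDimLE 0 (Subring.center R)] :
    Set.SurjOn (Ideal.comap (Subring.center R).subtype) (minPrimes R)
      (minimalPrimes (Subring.center R)) := by
  intro q hq
  have hqp : q.IsPrime := hq.1.1
  have hsum : ∑ i, φ.symm (Pi.single i 1) = 1 := by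
    rw [← map_sum]
    exact (congrArg φ.symm (Finset.univ_sum_single (1 : ∀ i, K i))).trans (map_one _)
  obtain ⟨i, hi⟩ : ∃ i, φ.symm (Pi.single i 1) ∉ q := by
    by_contra! hcon
    exact hqp.ne_top ((Ideal.eq_top_iff_one q).2 (hsum ▸ q.sum_mem fun i _ => hcon i))
  set e : Subring.center R := φ.symm (Pi.single i 1) with hedef
  have hee : e * e = e := by rw [hedef, ← map_mul, ← Pi.single_mul, one_mul]
  -- A nonzero `i`-th component of `z` could be inverted in `K i`, putting `e` into `q`.
  have hqe : ∀ z ∈ q, z * e = 0 := by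
    intro z hz
    have hz0 : φ z i = 0 := by
      by_contra h0
      refine hi ?_
      have : e = φ.symm (Pi.single i (φ z i)⁻¹) * z := by
        refine φ.injective (funext fun j => ?_)
        by_cases hj : j = i
        · subst hj; simp [hedef, h0]
        · simp [hedef, hj]
      rw [this]
      exact q.mul_mem_left _ hz
    refine φ.injective (funext fun j => ?_)
    by_cases hj : j = i
    · subst hj; simp [hedef, hz0]
    · simp [hedef, hj]
  -- Any prime over `R(1 - e)` contains `q`. It and a minimal prime below it contract to the same
  -- ideal as `q`, by maximality of primes in the centre.
  obtain ⟨P, hP, hle⟩ := exists_isPrimeIdeal_ge_of_ne_top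
    (I := Ideal.span {((1 - e : Subring.center R) : R)}) inferInstance (by
      intro htop
      rw [Ideal.eq_top_iff_one, ← Ideal.Quotient.eq_zero_iff_mem, mk_one_sub_eq_zero_iff hee,
        one_mul] at htop
      exact hi ((Subtype.ext htop : e = 0) ▸ q.zero_mem))
  have hqP : q ≤ P.comap (Subring.center R).subtype := by
    intro z hz
    refine hle ?_
    rw [← Ideal.Quotient.eq_zero_iff_mem, mk_one_sub_eq_zero_iff hee]
    exact congrArg Subtype.val (hqe z hz)
  obtain ⟨Q, hQ, hQP⟩ := exists_minPrimes_le hP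
  have hPp := hP.comap_center
  have hQp := (Minimal.prop hQ).comap_center
  refine ⟨Q, hQ, ?_⟩
  rw [(hqp.isMaximal').eq_of_le hPp.ne_top hqP]
  exact (hQp.isMaximal').eq_of_le hPp.ne_top (Ideal.comap_mono hQP)

end Center

end NoncommRing

theorem corollary4 {R : Type u} [Ring R] {n : ℕ} {K : Fin n → Type v} [∀ i, Field (K i)]
    (φ : Subring.center R ≃+* (∀ i, K i)) (e : Fin n → Subring.center R)
    (he : ∀ i, e i = φ.symm (Pi.single i 1)) :
    ((∃ h : NoncommRing.HasLeftQuotientRing R,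
        IsSemisimpleRing (NoncommRing.LeftQuotientRing R h)) ↔
      (NoncommRing.IsSemiprimeRing R ∧
        ∀ i, NoncommRing.IsLeftGoldie (NoncommRing.FactorRing R (1 - e i)))) ∧
    (∀ h : NoncommRing.HasLeftQuotientRing R,
      IsSemisimpleRing (NoncommRing.LeftQuotientRing R h) →
      (∃ h' : ∀ i, NoncommRing.HasLeftQuotientRing (NoncommRing.FactorRing R (1 - e i)),
        Nonempty (NoncommRing.LeftQuotientRing R h ≃+*
          (∀ i, NoncommRing.LeftQuotientRing (NoncommRing.FactorRing R (1 - e i)) (h' i))) ∧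
        (∀ i, Nonempty
          (NoncommRing.LeftQuotientRing (NoncommRing.FactorRing R (1 - e i)) (h' i) ≃+*
            NoncommRing.FactorRing (NoncommRing.LeftQuotientRing R h)
              (NoncommRing.LeftQuotientRing.ofCenter R h (1 - e i))))) ∧
      Set.MapsTo (Ideal.comap (Subring.center R).subtype)
        (NoncommRing.minPrimes R) (minimalPrimes (Subring.center R)) ∧
      Set.SurjOn (Ideal.comap (Subring.center R).subtype)
        (NoncommRing.minPrimes R) (minimalPrimes (Subring.center R))) := by
  have he' : CompleteOrthogonalIdempotents e := by
    obtain rfl : e = φ.symm ∘ fun i => Pi.single i 1 := funext he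
    exact (CompleteOrthogonalIdempotents.single K).map φ.symm.toRingHom
  have hdim : Ring.KrullDimLE 0 (Subring.center R) := by
    have : IsArtinianRing (Subring.center R) :=
      φ.symm.surjective.isArtinianRing (f := φ.symm.toRingHom)
    infer_instance
  exact ⟨NoncommRing.exists_isSemisimpleRing_iff he', fun h _ =>
    ⟨NoncommRing.exists_leftQuotientRing_equivs he' h,
      NoncommRing.mapsTo_comap_center_minPrimes, NoncommRing.surjOn_comap_center_minPrimes φ⟩⟩
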